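/- Let $d\lambda(z)=\frac1\pi e^{-|z|^2}\,dA(z)$ be the Gaussian measure on $\mathbb C$ and let $F^2$ be the Fock space of all entire functions in $L^2(\mathbb C,d\lambda)$, with the inner product of $L^2(\mathbb C,d\lambda)$. For $s,t\in\mathbb C$ with $s\neq 0$ let $T^{(s,t)}$ be the integral operator $$T^{(s,t)}f(z)=\int_{\mathbb C}\frac1{\sqrt s}\exp\left[\frac{tz^2-\overline{t w^2}+2z\overline w}{2s}\right]f(w)\,d\lambda(w),$$ where $\sqrt s=\sqrt{|s|}\,e^{i\varphi/2}$ if $s=|s|e^{i\varphi}$ with $\varphi\in(-\pi,\pi]$. Let $s,t\in\mathbb C$ satisfy $|s|^2=1+|t|^2$ and $|\mathrm{Re}\,s|<1$. Then the equation $$s\overline t\,\gamma^2+(s^2-1-|t|^2)\gamma-st=0$$ has exactly one solution $\gamma$ with $|\gamma|<1$; for this $\gamma$ there is exactly one $\theta\in(-\pi,\pi]$ with $1/(s+\overline t\gamma)=e^{i\theta}$; and $T^{(s,t)}$ is a unitary operator on $F^2$: for every $f\in F^2$ the integral converges absolutely for every $z\in\mathbb C$ and defines an entire function in $F^2$, and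 $f\mapsto T^{(s,t)}f$ is a unitary operator from $F^2$ onto $F^2$. If $\theta$ is not a rational multiple of $\pi$, then the spectrum of $T^{(s,t)}$ on $F^2$ is the full unit circle $\{z\in\mathbb C:|z|=1\}$. -/

import Mathlib

open MeasureTheory
open scoped ComplexConjugate

namespace FockLCT

/-- The Gaussian measure `dλ(z) = π⁻¹ exp(-|z|²) dA(z)` on `ℂ`. -/
noncomputable def gaussian : Measure ℂ :=
  (volume : Measure ℂ).withDensity
    (fun z => ENNReal.ofReal (Real.exp (-‖z‖ ^ 2) / Real.pi))

/-- The Fock space `F² = L²(ℂ, dλ) ∩ H(ℂ)`: the classes in `L²(ℂ, dλ)` that have an entire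
representative, with the norm and inner product of `L²(ℂ, dλ)`. -/
noncomputable def fock : Submodule ℂ (Lp ℂ 2 gaussian) where
  carrier := {f | ∃ g : ℂ → ℂ, Differentiable ℂ g ∧ (f : ℂ → ℂ) =ᵐ[gaussian] g}
  add_mem' := by
    rintro f₁ f₂ ⟨g₁, hg₁, h₁⟩ ⟨g₂, hg₂, h₂⟩
    exact ⟨g₁ + g₂, hg₁.add hg₂, (Lp.coeFn_add f₁ f₂).trans (h₁.add h₂)⟩
  zero_mem' := ⟨0, differentiable_const 0, Lp.coeFn_zero ℂ 2 gaussian⟩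
  smul_mem' := by
    rintro c f ⟨g, hg, h⟩
    exact ⟨c • g, hg.const_smul c, (Lp.coeFn_smul c f).trans (h.const_smul c)⟩

/-- The complex square root `√z = √|z| exp(iθ/2)`, where `z = |z| exp(iθ)` with `-π < θ ≤ π`. -/
noncomputable def csqrt (z : ℂ) : ℂ :=
  (Real.sqrt ‖z‖ : ℂ) * Complex.exp (Complex.I * ((z.arg / 2 : ℝ) : ℂ))

/-- The kernel `K^{(s,t)}(z,w)`. -/
noncomputable def kernel (s t z w : ℂ) : ℂ :=
  1 / csqrt s * Complex.exp ((t * z ^ 2 - conj (t * w ^ 2) + 2 * z * conj w) / (2 * s))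

/-- The function `z ↦ ∫ K^{(s,t)}(z,w) f(w) dλ(w)`. -/
noncomputable def transform (s t : ℂ) (f : ℂ → ℂ) (z : ℂ) : ℂ :=
  ∫ w, kernel s t z w * f w ∂gaussian

/-- `T` is the integral operator `T^{(s,t)}` on the whole of `F²`: for every `f` in `F²` the
defining integral converges absolutely at every point, it is an entire function of `z`, and this
entire function is `T f`. At most one `T` has this property. -/
def IsIntegralOperator (s t : ℂ) (T : fock →L[ℂ] fock) : Prop :=
  ∀ f : fock,
    (∀ z : ℂ, Integrable (fun w => kernel s t z w * ((f : Lp ℂ 2 gaussian) : ℂ → ℂ) w) gaussian) ∧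
    Differentiable ℂ (transform s t ((f : Lp ℂ 2 gaussian) : ℂ → ℂ)) ∧
    ((T f : Lp ℂ 2 gaussian) : ℂ → ℂ) =ᵐ[gaussian]
      transform s t ((f : Lp ℂ 2 gaussian) : ℂ → ℂ)

/-- `γ` is a solution in the open unit disk of
`s t̄ γ² + (s² - 1 - |t|²) γ - s t = 0`. -/
def IsDiskRoot (s t γ : ℂ) : Prop :=
  ‖γ‖ < 1 ∧ s * conj t * γ ^ 2 + (s ^ 2 - 1 - (‖t‖ : ℂ) ^ 2) * γ - s * t = 0

/-- `θ` is the number in `(-π, π]` with `1 / (s + t̄ γ) = exp(iθ)`. -/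
def IsAngle (s t γ : ℂ) (θ : ℝ) : Prop :=
  θ ∈ Set.Ioc (-Real.pi) Real.pi ∧ 1 / (s + conj t * γ) = Complex.exp (Complex.I * (θ : ℂ))

end FockLCT

namespace FockLCT

/-! Everything is read off the reproducing kernels `reproKernel a`. Their span is dense, so a
bounded operator is determined by its values on them, and any family with the same Gram matrix is
their image under a linear isometry (`exists_linearIsometry_of_inner_eq`).

Unitarity: an explicit Gaussian integral shows that the functions `conjKernel s t z` have this Gram
matrix. The kernel for `(conj s, -t)` is the conjugate transpose of the one for `(s, t)`, so the
isometry built from `(conj s, -t)` is the integral operator itself, and the isometry built from `(s,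
t)` is a right inverse of it.

Spectrum: the matrix with rows (s̄, t), (t̄, s) has determinant 1 and trace 2 Re s, so for |Re s| <
1 its Möbius action on the disk is elliptic. Its fixed point in the disk is γ, and s + t̄γ is a
unimodular eigenvalue. Moving γ to 0 turns the operator into a rotation: an isometry `W` onto
multiples of Gaussians with quadratic coefficient γ satisfies U W = c W R with R f(z) = f(e^{iθ}z)
(`exists_intertwining`). The monomials are eigenvectors of R, so the vectors W zⁿ are eigenvectors
of U with eigenvalues c e^{inθ}. These are dense in the unit circle when θ/π is irrational, and the
spectrum is a closed subset of the circle. -/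

/-! ### Gaussian integrals over the plane. -/

theorem integral_gaussian (f : ℂ → ℂ) :
    ∫ z, f z ∂gaussian = ∫ z, (Real.exp (-‖z‖ ^ 2) / Real.pi : ℝ) • f z := by
  rw [gaussian, integral_withDensity_eq_integral_toReal_smul (by fun_prop) (by simp)]
  congr 1
  ext z
  rw [ENNReal.toReal_ofReal (by positivity)]

theorem integrable_gaussian_iff {f : ℂ → ℂ} :
    Integrable f gaussian ↔
      Integrable (fun z => (Real.exp (-‖z‖ ^ 2) / Real.pi : ℝ) • f z) := by
  rw [gaussian, integrable_withDensity_iff_integrable_smul' (by fun_prop) (by simp)]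
  refine integrable_congr (ae_of_all _ fun z => ?_)
  simp only [ENNReal.toReal_ofReal (show (0 : ℝ) ≤ Real.exp (-‖z‖ ^ 2) / Real.pi by positivity)]

theorem integrable_exp_quadratic_norm {c : ℝ} (hc : 0 < c) (d : ℝ) :
    Integrable (fun z : ℂ => Real.exp (-c * ‖z‖ ^ 2 + d * ‖z‖)) := by
  -- Half of the quadratic decay absorbs the linear term: dx ≤ cx²/2 + d²/(2c).
  have h := (GaussianFourier.integrable_cexp_neg_mul_sq_norm_add (V := ℂ) (b := ((c / 2 : ℝ) : ℂ))
    (by simpa using hc) 0 0).norm.const_mul (Real.exp (d ^ 2 / (2 * c)))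
  refine h.mono' (by fun_prop) (ae_of_all _ fun z => ?_)
  rw [Complex.norm_exp, Real.norm_eq_abs, Real.abs_exp, ← Real.exp_add]
  refine Real.exp_le_exp.mpr ?_
  have h1 : (-(((c / 2 : ℝ) : ℂ)) * (‖z‖ : ℂ) ^ 2 + 0 * ((inner ℝ (0 : ℂ) z : ℝ) : ℂ)).re =
      -(c / 2) * ‖z‖ ^ 2 := by
    rw [zero_mul, add_zero, ← Complex.ofReal_pow, ← Complex.ofReal_neg, ← Complex.ofReal_mul,
      Complex.ofReal_re]
  rw [h1]
  have h2 : d ^ 2 / (2 * c) + -(c / 2) * ‖z‖ ^ 2 - (-c * ‖z‖ ^ 2 + d * ‖z‖) =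
      (d - c * ‖z‖) ^ 2 / (2 * c) := by field_simp; ring
  have h3 : 0 ≤ (d - c * ‖z‖) ^ 2 / (2 * c) := by positivity
  linarith

theorem integrable_gaussian_of_norm_le {f : ℂ → ℂ} (hf : Continuous f) {A a d : ℝ} (ha : a < 1)
    (h : ∀ z, ‖f z‖ ≤ A * Real.exp (a * ‖z‖ ^ 2 + d * ‖z‖)) : Integrable f gaussian := by
  rw [integrable_gaussian_iff]
  refine ((integrable_exp_quadratic_norm (sub_pos.mpr ha) d).const_mul
    (A / Real.pi)).mono' (by fun_prop) (ae_of_all _ fun z => ?_)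
  rw [norm_smul, Real.norm_of_nonneg (by positivity)]
  calc _ ≤ Real.exp (-‖z‖ ^ 2) / Real.pi * (A * Real.exp (a * ‖z‖ ^ 2 + d * ‖z‖)) := by
        gcongr; exact h z
    _ = A / Real.pi * (Real.exp (-‖z‖ ^ 2) * Real.exp (a * ‖z‖ ^ 2 + d * ‖z‖)) := by ring
    _ = _ := by rw [← Real.exp_add]; ring_nf

theorem memLp_gaussian_of_norm_le {f : ℂ → ℂ} (hf : Continuous f) {A a d : ℝ} (ha : a < 1)
    (h : ∀ z, ‖f z‖ ≤ A * Real.exp (a * ‖z‖ ^ 2 / 2 + d * ‖z‖)) : MemLp f 2 gaussian := by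
  have hm : AEStronglyMeasurable f gaussian := hf.aestronglyMeasurable
  rw [← integrable_norm_rpow_iff hm (by norm_num) (by norm_num)]
  have h1 : Integrable (fun z => f z * f z) gaussian := by
    refine integrable_gaussian_of_norm_le (A := A ^ 2) (d := 2 * d) (by fun_prop) ha fun z => ?_
    rw [norm_mul, ← sq]
    calc ‖f z‖ ^ 2 ≤ (A * Real.exp (a * ‖z‖ ^ 2 / 2 + d * ‖z‖)) ^ 2 := by
          gcongr; exact h z
      _ = _ := by rw [mul_pow, ← Real.exp_nat_mul]; push_cast; ring_nf
  refine h1.norm.congr (ae_of_all _ fun z => ?_)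
  simp [sq]

/-- The map a ↦ 1/(1 - a) sends the disk into Re > 1/2, so m = 1/(1 - a) + 1/(1 - b) has real part
above 1, and the quotient equals 2(1 - 1/m). This gives convergence of the second integration in
`exists_integral_gaussian_cexp`. -/
theorem re_one_sub_mul_div_pos {a b : ℂ} (ha : ‖a‖ < 1) (hb : ‖b‖ < 1) :
    0 < ((1 - a * b) / (1 - (a + b) / 2)).re := by
  have key : ∀ c : ℂ, ‖c‖ < 1 → 1 - c ≠ 0 ∧ 1 / 2 < ((1 - c)⁻¹).re := by
    intro c hc
    have h0 : 1 - c ≠ 0 := by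
      intro h
      rw [← sub_eq_zero.mp h] at hc
      simp at hc
    refine ⟨h0, ?_⟩
    have h1 : Complex.normSq c < 1 := by
      rw [Complex.normSq_eq_norm_sq]; nlinarith [norm_nonneg c]
    rw [Complex.inv_re, lt_div_iff₀ (Complex.normSq_pos.mpr h0)]
    simp only [Complex.normSq_apply, Complex.sub_re, Complex.one_re, Complex.sub_im,
      Complex.one_im] at h1 ⊢
    nlinarith
  obtain ⟨ha0, ha1⟩ := key a ha
  obtain ⟨hb0, hb1⟩ := key b hb
  set m := (1 - a)⁻¹ + (1 - b)⁻¹ with hm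
  have hm1 : 1 < m.re := by rw [hm, Complex.add_re]; linarith
  have hm0 : m ≠ 0 := by rintro h; rw [h] at hm1; simp at hm1; linarith
  have hab : 1 - a + (1 - b) ≠ 0 := by
    intro h
    apply hm0
    rw [hm]
    field_simp
    linear_combination h
  have h2 : (1 - a * b) / (1 - (a + b) / 2) = 2 * (1 - m⁻¹) := by
    have h3 : m⁻¹ = (1 - a) * (1 - b) / (1 - a + (1 - b)) := by
      rw [hm]
      field_simp
      rw [add_comm (1 - b), div_self hab]
    rw [h3]
    have : 1 - (a + b) / 2 = (1 - a + (1 - b)) / 2 := by ring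
    rw [this]
    field_simp
    ring
  rw [h2]
  have h4 : (m⁻¹).re < 1 := by
    refine (Complex.re_le_norm _).trans_lt ?_
    rw [norm_inv]
    exact inv_lt_one_of_one_lt₀ (hm1.trans_le (Complex.re_le_norm m))
  simp only [Complex.mul_re, Complex.sub_re, Complex.one_re, Complex.re_ofNat, Complex.im_ofNat]
  linarith

theorem norm_cexp_quadratic_le (a b c d w : ℂ) :
    ‖Complex.exp (a * w ^ 2 / 2 + b * conj w ^ 2 / 2 + c * w + d * conj w)‖ ≤
      Real.exp ((‖a‖ + ‖b‖) / 2 * ‖w‖ ^ 2 + (‖c‖ + ‖d‖) * ‖w‖) := by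
  rw [Complex.norm_exp]
  refine Real.exp_le_exp.mpr ((Complex.re_le_norm _).trans ?_)
  calc _ ≤ ‖a * w ^ 2 / 2‖ + ‖b * conj w ^ 2 / 2‖ + ‖c * w‖ + ‖d * conj w‖ :=
        (norm_add_le _ _).trans (add_le_add (norm_add₃_le) le_rfl)
    _ = _ := by simp; ring

/-- Fubini and two one-dimensional Gaussian integrals. The constant is a product of two principal
square roots. It is evaluated only for b = ā, where both radicands are positive; otherwise only its
independence of c and d is needed. -/
theorem exists_integral_gaussian_cexp {a b : ℂ} (ha : ‖a‖ < 1) (hb : ‖b‖ < 1) :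
    ∃ C : ℂ, (b = conj a → C = ((Real.sqrt (1 - ‖a‖ ^ 2))⁻¹ : ℝ)) ∧ ∀ c d : ℂ,
      ∫ w, Complex.exp (a * w ^ 2 / 2 + b * conj w ^ 2 / 2 + c * w + d * conj w) ∂gaussian =
        C * Complex.exp ((a * d ^ 2 + b * c ^ 2 + 2 * c * d) / (2 * (1 - a * b))) := by
  set p : ℂ := (a + b) / 2 with hp
  set q : ℂ := (a - b) / 2 with hq
  have hpn : ‖p‖ < 1 := by
    rw [hp, norm_div, Complex.norm_ofNat]
    linarith [norm_add_le a b]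
  have hpre : 0 < (1 - p).re := by
    have := (Complex.re_le_norm p).trans_lt hpn
    simpa using this
  have hp0 : 1 - p ≠ 0 := by rintro h; rw [h] at hpre; simp at hpre
  have hab0 : 1 - a * b ≠ 0 := by
    intro h
    have := re_one_sub_mul_div_pos ha hb
    rw [h] at this
    simp at this
  -- This is the coefficient of y² left after the integration in x.
  have hQ : -(1 + p) - q ^ 2 / (1 - p) = -((1 - a * b) / (1 - p)) := by
    field_simp
    rw [hp, hq]
    ring
  have hQre : (-(1 + p) - q ^ 2 / (1 - p)).re < 0 := by
    rw [hQ, Complex.neg_re]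
    have := re_one_sub_mul_div_pos ha hb
    linarith
  refine ⟨(Real.pi : ℂ)⁻¹ * ((Real.pi / -(-(1 - p))) ^ (1 / 2 : ℂ) *
    (Real.pi / -(-(1 + p) - q ^ 2 / (1 - p))) ^ (1 / 2 : ℂ)), ?_, ?_⟩
  · intro hba
    have h1 : p = (a.re : ℂ) := by
      rw [hp, hba, Complex.add_conj]; push_cast; ring
    have h2 : a * b = ((‖a‖ ^ 2 : ℝ) : ℂ) := by
      rw [hba, Complex.mul_conj, Complex.normSq_eq_norm_sq]
    rw [hQ, neg_neg, neg_neg, h1, h2]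
    have h3 : 0 < 1 - a.re := by linarith [(Complex.re_le_norm a).trans_lt ha]
    have h4 : 0 < 1 - ‖a‖ ^ 2 := by nlinarith [norm_nonneg a]
    have e1 : (1 / 2 : ℂ) = ((1 / 2 : ℝ) : ℂ) := by push_cast; ring
    have e2 : (Real.pi : ℂ) / (1 - (a.re : ℂ)) = ((Real.pi / (1 - a.re) : ℝ) : ℂ) := by
      push_cast; ring
    have e3 : (Real.pi : ℂ) / ((1 - ((‖a‖ ^ 2 : ℝ) : ℂ)) / (1 - (a.re : ℂ))) =
        ((Real.pi / ((1 - ‖a‖ ^ 2) / (1 - a.re)) : ℝ) : ℂ) := by push_cast; ring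
    rw [e1, e2, e3, ← Complex.ofReal_cpow (by positivity), ← Complex.ofReal_cpow (by positivity),
      ← Complex.ofReal_inv, ← Complex.ofReal_mul, ← Complex.ofReal_mul, ← Real.sqrt_eq_rpow,
      ← Real.sqrt_eq_rpow, ← Real.sqrt_mul (by positivity)]
    congr 1
    have e4 : Real.pi / (1 - a.re) * (Real.pi / ((1 - ‖a‖ ^ 2) / (1 - a.re))) =
        Real.pi ^ 2 * (1 - ‖a‖ ^ 2)⁻¹ := by field_simp
    rw [e4, Real.sqrt_mul (by positivity), Real.sqrt_sq (by positivity), Real.sqrt_inv]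
    field_simp
  · intro c d
    have hint : Integrable (fun w : ℂ => (Real.exp (-‖w‖ ^ 2) / Real.pi : ℝ) •
        Complex.exp (a * w ^ 2 / 2 + b * conj w ^ 2 / 2 + c * w + d * conj w)) := by
      rw [← integrable_gaussian_iff]
      refine integrable_gaussian_of_norm_le (A := 1) (a := (‖a‖ + ‖b‖) / 2) (d := ‖c‖ + ‖d‖)
        ?_ (by linarith) fun w => ?_
      · have : Continuous (fun w : ℂ => conj w) := Complex.continuous_conj
        fun_prop
      · rw [one_mul]
        exact norm_cexp_quadratic_le a b c d w
    rw [integral_gaussian]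
    have hval : ∀ x y : ℝ, (Real.exp (-‖(x + y * Complex.I : ℂ)‖ ^ 2) / Real.pi : ℝ) •
        Complex.exp (a * (x + y * Complex.I) ^ 2 / 2 + b * conj (x + y * Complex.I : ℂ) ^ 2 / 2 +
          c * (x + y * Complex.I) + d * conj (x + y * Complex.I : ℂ)) =
        (Real.pi : ℂ)⁻¹ * Complex.exp ((-(1 - p)) * (x : ℂ) ^ 2 +
          (2 * Complex.I * q * y + (c + d)) * x +
          (-(1 + p) * (y : ℂ) ^ 2 + Complex.I * (c - d) * y)) := by
      intro x y
      have e1 : -‖(x + y * Complex.I : ℂ)‖ ^ 2 = -(x ^ 2 + y ^ 2) := by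
        rw [← Complex.normSq_eq_norm_sq, Complex.normSq_add_mul_I]
      rw [Complex.real_smul, e1, Complex.ofReal_div, div_eq_inv_mul, mul_assoc, Complex.ofReal_exp,
        ← Complex.exp_add]
      congr 2
      simp only [map_add, map_mul, Complex.conj_ofReal, Complex.conj_I, hp, hq]
      push_cast
      linear_combination ((a + b) * y ^ 2 / 2) * Complex.I_sq
    have hswap : ∫ w : ℂ, (Real.exp (-‖w‖ ^ 2) / Real.pi : ℝ) •
        Complex.exp (a * w ^ 2 / 2 + b * conj w ^ 2 / 2 + c * w + d * conj w) =
        ∫ y : ℝ, ∫ x : ℝ, (Real.pi : ℂ)⁻¹ * Complex.exp ((-(1 - p)) * (x : ℂ) ^ 2 +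
          (2 * Complex.I * q * y + (c + d)) * x +
          (-(1 + p) * (y : ℂ) ^ 2 + Complex.I * (c - d) * y)) := by
      have hmp := Complex.volume_preserving_equiv_real_prod.symm
      rw [← hmp.integral_comp Complex.measurableEquivRealProd.symm.measurableEmbedding,
        Measure.volume_eq_prod, integral_prod_symm]
      · refine integral_congr_ae (ae_of_all _ fun y => integral_congr_ae (ae_of_all _ fun x => ?_))
        have e : Complex.measurableEquivRealProd.symm (x, y) = (x + y * Complex.I : ℂ) := by
          apply Complex.ext <;> simp [Complex.measurableEquivRealProd]
        simp only [e]
        exact hval x y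
      · exact (hmp.integrable_comp_emb
          Complex.measurableEquivRealProd.symm.measurableEmbedding).mpr hint
    rw [hswap]
    have hx : ∀ y : ℝ, ∫ x : ℝ, (Real.pi : ℂ)⁻¹ * Complex.exp ((-(1 - p)) * (x : ℂ) ^ 2 +
          (2 * Complex.I * q * y + (c + d)) * x +
          (-(1 + p) * (y : ℂ) ^ 2 + Complex.I * (c - d) * y)) =
        (Real.pi : ℂ)⁻¹ * ((Real.pi / -(-(1 - p))) ^ (1 / 2 : ℂ) *
          Complex.exp ((-(1 + p) - q ^ 2 / (1 - p)) * (y : ℂ) ^ 2 +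
            (Complex.I * (c - d) + Complex.I * q * (c + d) / (1 - p)) * y +
            (c + d) ^ 2 / (4 * (1 - p)))) := by
      intro y
      rw [integral_const_mul, integral_cexp_quadratic (by simpa using hpre)]
      congr 3
      field_simp
      linear_combination (4 * q ^ 2 * y ^ 2) * Complex.I_sq
    simp_rw [hx]
    rw [integral_const_mul, integral_const_mul, integral_cexp_quadratic hQre]
    have hexp : (c + d) ^ 2 / (4 * (1 - p)) -
        (Complex.I * (c - d) + Complex.I * q * (c + d) / (1 - p)) ^ 2 /
          (4 * (-(1 + p) - q ^ 2 / (1 - p))) =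
        (a * d ^ 2 + b * c ^ 2 + 2 * c * d) / (2 * (1 - a * b)) := by
      rw [hQ]
      have ha' : a = p + q := by rw [hp, hq]; ring
      have hb' : b = p - q := by rw [hp, hq]; ring
      clear_value p q
      subst ha' hb'
      field_simp
      linear_combination (2 * (c * (1 - p + q) - d * (1 - p - q)) ^ 2) * Complex.I_sq
    rw [hexp]
    ring

instance : IsFiniteMeasure gaussian := by
  have h : Integrable (fun _ : ℂ => (1 : ℂ)) gaussian :=
    integrable_gaussian_of_norm_le (A := 1) (a := 0) (d := 0) continuous_const (by norm_num)
      (fun z => by simp)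
  rcases integrable_const_iff.mp h with h | h
  · simp at h
  · exact h

theorem gaussian_real_univ : gaussian.real Set.univ = 1 := by
  obtain ⟨C, hC, h⟩ := exists_integral_gaussian_cexp (a := 0) (b := 0) (by simp) (by simp)
  have h1 := h 0 0
  rw [hC (by simp)] at h1
  simpa using h1

/-! ### Mean value property and reproducing kernels. -/

theorem measurePreserving_rotation_gaussian (u : Circle) :
    MeasurePreserving (rotation u) gaussian gaussian := by
  have hv := (rotation u).measurePreserving
  refine ⟨hv.measurable, ?_⟩
  ext s hs
  rw [Measure.map_apply hv.measurable hs, gaussian, withDensity_apply _ hs,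
    withDensity_apply _ (hv.measurable hs)]
  refine Eq.trans ?_ (hv.setLIntegral_comp_preimage hs (by fun_prop))
  simp only [LinearIsometryEquiv.norm_map]

/-- The measure is rotation invariant, so the integral equals its average over all rotations of g.
After exchanging the integrals, the mean value property on circles gives g 0. -/
theorem integral_gaussian_of_differentiable {g : ℂ → ℂ} (hg : Differentiable ℂ g)
    (hi : Integrable g gaussian) : ∫ w, g w ∂gaussian = g 0 := by
  have hrot : ∀ φ : ℝ, (fun w => g (circleMap 0 1 φ * w)) = g ∘ rotation (Circle.exp φ) := by
    intro φ
    ext w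
    simp [circleMap]
  have hint : ∀ φ : ℝ, ∫ w, g (circleMap 0 1 φ * w) ∂gaussian = ∫ w, g w ∂gaussian := fun φ =>
    (congrArg (fun F => ∫ w, F w ∂gaussian) (hrot φ)).trans
      ((measurePreserving_rotation_gaussian (Circle.exp φ)).integral_comp
        (rotation (Circle.exp φ)).toMeasurableEquiv.measurableEmbedding g)
  have hnorm : ∀ φ : ℝ, ∫ w, ‖g (circleMap 0 1 φ * w)‖ ∂gaussian = ∫ w, ‖g w‖ ∂gaussian :=
    fun φ => (congrArg (fun F => ∫ w, ‖F w‖ ∂gaussian) (hrot φ)).trans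
      ((measurePreserving_rotation_gaussian (Circle.exp φ)).integral_comp
        (rotation (Circle.exp φ)).toMeasurableEquiv.measurableEmbedding (fun w => ‖g w‖))
  have hcont : Continuous (Function.uncurry fun (φ : ℝ) (w : ℂ) => g (circleMap 0 1 φ * w)) :=
    hg.continuous.comp (((continuous_circleMap 0 1).comp continuous_fst).mul continuous_snd)
  have hprod : Integrable (Function.uncurry fun (φ : ℝ) (w : ℂ) => g (circleMap 0 1 φ * w))
      ((volume.restrict (Set.uIoc 0 (2 * Real.pi))).prod gaussian) := by
    rw [integrable_prod_iff hcont.aestronglyMeasurable]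
    refine ⟨ae_of_all _ fun φ => ?_, ?_⟩
    · change Integrable (fun w => g (circleMap 0 1 φ * w)) gaussian
      rw [hrot φ]
      exact (measurePreserving_rotation_gaussian (Circle.exp φ)).integrable_comp_of_integrable hi
    · simp only [Function.uncurry, hnorm]
      exact (intervalIntegrable_const (μ := volume)).def'
  have havg : ∀ w : ℂ, ∫ φ in (0 : ℝ)..2 * Real.pi, g (circleMap 0 1 φ * w) =
      (2 * Real.pi : ℝ) • g 0 := by
    intro w
    have h := DiffContOnCl.circleAverage (f := fun u => g (u * w)) (c := 0) (R := 1)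
      (Differentiable.diffContOnCl (by fun_prop))
    rw [Real.circleAverage, inv_smul_eq_iff₀ (by positivity), zero_mul] at h
    exact h
  have h := intervalIntegral_integral_swap hprod
  simp only [hint, havg, intervalIntegral.integral_const, integral_const, gaussian_real_univ,
    one_smul, sub_zero] at h
  exact smul_right_injective ℂ (show (2 * Real.pi : ℝ) ≠ 0 by positivity) h

theorem norm_cexp_add_le (α β w : ℂ) : ‖Complex.exp (α * w ^ 2 / 2 + β * w)‖ ≤
    1 * Real.exp (‖α‖ * ‖w‖ ^ 2 / 2 + ‖β‖ * ‖w‖) := by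
  rw [Complex.norm_exp, one_mul]
  refine Real.exp_le_exp.mpr ((Complex.re_le_norm _).trans ((norm_add_le _ _).trans (le_of_eq ?_)))
  simp

theorem memLp_cexp {α : ℂ} (hα : ‖α‖ < 1) (β : ℂ) :
    MemLp (fun w => Complex.exp (α * w ^ 2 / 2 + β * w)) 2 gaussian :=
  memLp_gaussian_of_norm_le (by fun_prop) hα (norm_cexp_add_le α β)

/-- The element of the Fock space represented by a square integrable entire function. -/
noncomputable def ofEntire (g : ℂ → ℂ) (hg : Differentiable ℂ g) (hm : MemLp g 2 gaussian) :
    fock :=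
  ⟨hm.toLp g, g, hg, hm.coeFn_toLp⟩

theorem coeFn_ofEntire (g : ℂ → ℂ) (hg : Differentiable ℂ g) (hm : MemLp g 2 gaussian) :
    ((ofEntire g hg hm : Lp ℂ 2 gaussian) : ℂ → ℂ) =ᵐ[gaussian] g :=
  hm.coeFn_toLp

theorem inner_eq_integral {f₁ f₂ : Lp ℂ 2 gaussian} {g₁ g₂ : ℂ → ℂ} (h₁ : f₁ =ᵐ[gaussian] g₁)
    (h₂ : f₂ =ᵐ[gaussian] g₂) : inner ℂ f₁ f₂ = ∫ w, conj (g₁ w) * g₂ w ∂gaussian := by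
  rw [L2.inner_def]
  refine integral_congr_ae ?_
  filter_upwards [h₁, h₂] with w e₁ e₂
  rw [e₁, e₂, RCLike.inner_apply, mul_comm]

/-- The Gaussian `w ↦ exp(αw²/2 + βw)` as an element of the Fock space. -/
noncomputable def gaussianFun (α : ℂ) (hα : ‖α‖ < 1) (β : ℂ) : fock :=
  ofEntire (fun w => Complex.exp (α * w ^ 2 / 2 + β * w)) (by fun_prop) (memLp_cexp hα β)

/-- The reproducing kernel `w ↦ exp(z̄w)` of the Fock space. -/
noncomputable def reproKernel (z : ℂ) : fock := gaussianFun 0 (by simp) (conj z)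

theorem coeFn_reproKernel (z : ℂ) :
    ((reproKernel z : Lp ℂ 2 gaussian) : ℂ → ℂ) =ᵐ[gaussian] fun w => Complex.exp (conj z * w) :=
  (coeFn_ofEntire (fun w => Complex.exp (0 * w ^ 2 / 2 + conj z * w)) (by fun_prop)
    (memLp_cexp (by simp) _)).trans (Filter.EventuallyEq.of_eq (by ext; simp))

theorem integral_reproducing {g : ℂ → ℂ} (hg : Differentiable ℂ g) (hm : MemLp g 2 gaussian)
    (z : ℂ) : ∫ w, Complex.exp (z * conj w) * g w ∂gaussian = g z := by
  have he : MemLp (fun w => Complex.exp (z * conj w)) 2 gaussian := by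
    have hc : Continuous (fun w : ℂ => conj w) := Complex.continuous_conj
    refine memLp_gaussian_of_norm_le (A := 1) (a := 0) (d := ‖z‖) (by fun_prop) (by norm_num)
      fun w => ?_
    rw [Complex.norm_exp, one_mul]
    refine Real.exp_le_exp.mpr ((Complex.re_le_norm _).trans (le_of_eq ?_))
    simp
  have hi : Integrable (fun w => Complex.exp (z * conj w) * g w) gaussian := he.integrable_mul hm
  -- Translating by z moves the point of evaluation to 0: the weight and the kernel combine into the
  -- weight times an entire function of w, to which the mean value property applies.
  have hshift : ∀ w, (Real.exp (-‖w + z‖ ^ 2) / Real.pi : ℝ) •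
      (Complex.exp (z * conj (w + z)) * g (w + z)) =
      (Real.exp (-‖w‖ ^ 2) / Real.pi : ℝ) • (Complex.exp (-(conj z * w)) * g (w + z)) := by
    intro w
    simp only [Complex.real_smul, Complex.ofReal_div, Complex.ofReal_exp, ← mul_assoc]
    congr 1
    rw [div_mul_eq_mul_div, div_mul_eq_mul_div, ← Complex.exp_add, ← Complex.exp_add]
    congr 2
    simp only [← Complex.normSq_eq_norm_sq]
    push_cast
    simp only [← Complex.mul_conj, map_add]
    ring
  have hi' : Integrable (fun w => Complex.exp (-(conj z * w)) * g (w + z)) gaussian := by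
    rw [integrable_gaussian_iff] at hi ⊢
    simpa only [hshift] using hi.comp_add_right z
  have h := integral_gaussian_of_differentiable
    (g := fun w => Complex.exp (-(conj z * w)) * g (w + z)) (by fun_prop) hi'
  rw [integral_gaussian] at h ⊢
  rw [← integral_add_right_eq_self _ z]
  simp only [hshift]
  rw [h]
  simp

theorem inner_reproKernel {f : fock} {g : ℂ → ℂ} (hg : Differentiable ℂ g)
    (h : ((f : Lp ℂ 2 gaussian) : ℂ → ℂ) =ᵐ[gaussian] g) (z : ℂ) :
    inner ℂ (reproKernel z) f = g z := by
  rw [Submodule.coe_inner, inner_eq_integral (coeFn_reproKernel z) h,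
    ← integral_reproducing hg ((memLp_congr_ae h).mp (Lp.memLp _)) z]
  simp only [← Complex.exp_conj, map_mul, Complex.conj_conj]

theorem inner_reproKernel_ofEntire {g : ℂ → ℂ} (hg : Differentiable ℂ g)
    (hm : MemLp g 2 gaussian) (z : ℂ) : inner ℂ (reproKernel z) (ofEntire g hg hm) = g z :=
  inner_reproKernel hg (coeFn_ofEntire g hg hm) z

theorem inner_reproKernel_gaussianFun {α : ℂ} (hα : ‖α‖ < 1) (β z : ℂ) :
    inner ℂ (reproKernel z) (gaussianFun α hα β) = Complex.exp (α * z ^ 2 / 2 + β * z) :=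
  inner_reproKernel_ofEntire _ _ z

theorem inner_reproKernel_reproKernel (z w : ℂ) :
    inner ℂ (reproKernel z) (reproKernel w) = Complex.exp (conj w * z) := by
  rw [reproKernel.eq_def w, inner_reproKernel_gaussianFun]
  simp

theorem differentiable_inner_reproKernel (f : fock) :
    Differentiable ℂ fun z => inner ℂ (reproKernel z) f := by
  obtain ⟨g, hg, h⟩ := f.2
  simpa only [inner_reproKernel hg h] using hg

theorem coeFn_eq_inner_reproKernel (f : fock) :
    ((f : Lp ℂ 2 gaussian) : ℂ → ℂ) =ᵐ[gaussian] fun z => inner ℂ (reproKernel z) f := by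
  obtain ⟨g, hg, h⟩ := f.2
  simpa only [inner_reproKernel hg h] using h

theorem fock_ext {f g : fock}
    (h : ∀ z, inner ℂ (reproKernel z) f = inner ℂ (reproKernel z) g) : f = g := by
  refine Subtype.ext (Lp.ext ?_)
  refine (coeFn_eq_inner_reproKernel f).trans (Filter.EventuallyEq.trans ?_
    (coeFn_eq_inner_reproKernel g).symm)
  simp only [h]
  rfl

theorem norm_reproKernel_sq (z : ℂ) : ‖reproKernel z‖ ^ 2 = Real.exp (‖z‖ ^ 2) := by
  have h := inner_self_eq_norm_sq_to_K (𝕜 := ℂ) (reproKernel z)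
  rw [inner_reproKernel_reproKernel, mul_comm, Complex.mul_conj, Complex.normSq_eq_norm_sq,
    ← Complex.ofReal_exp] at h
  exact Complex.ofReal_injective (by rw [h]; push_cast; rfl)

open Filter Topology in
-- Evaluation at z is pairing with a vector of norm exp(|z|²/2), so norm convergence forces locally
-- uniform convergence and the limit is entire. An a.e. convergent subsequence identifies it with
-- the L² limit.
theorem isClosed_fock : IsClosed (fock : Set (Lp ℂ 2 gaussian)) := by
  refine isClosed_of_closure_subset fun f hf => ?_
  obtain ⟨u, hu, hlim⟩ := mem_closure_iff_seq_limit.mp hf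
  set G : ℂ → ℂ := fun z => inner ℂ (reproKernel z : Lp ℂ 2 gaussian) f with hG
  set F : ℕ → ℂ → ℂ := fun n z => inner ℂ (reproKernel z : Lp ℂ 2 gaussian) (u n) with hF
  have hFd : ∀ n, Differentiable ℂ (F n) := fun n =>
    differentiable_inner_reproKernel ⟨u n, hu n⟩
  have hFu : ∀ n, (u n : ℂ → ℂ) =ᵐ[gaussian] F n := fun n =>
    coeFn_eq_inner_reproKernel ⟨u n, hu n⟩
  have hloc : TendstoLocallyUniformlyOn F G atTop Set.univ := by
    rw [tendstoLocallyUniformlyOn_iff_forall_isCompact isOpen_univ]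
    intro K _ hK
    obtain ⟨R, hR⟩ := hK.isBounded.exists_norm_le
    rw [Metric.tendstoUniformlyOn_iff]
    intro ε hε
    have h0 : Tendsto (fun n => Real.sqrt (Real.exp (R ^ 2)) * ‖f - u n‖) atTop (𝓝 0) := by
      have := (tendsto_const_nhds (x := f)).sub hlim
      rw [sub_self] at this
      simpa using this.norm.const_mul (Real.sqrt (Real.exp (R ^ 2)))
    filter_upwards [h0.eventually_lt_const hε] with n hn z hz
    refine lt_of_le_of_lt ?_ hn
    rw [dist_eq_norm, hG, hF, ← inner_sub_right]
    refine (norm_inner_le_norm _ _).trans (mul_le_mul_of_nonneg_right ?_ (norm_nonneg _))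
    refine Real.le_sqrt_of_sq_le ?_
    rw [← Submodule.coe_norm, norm_reproKernel_sq]
    exact Real.exp_le_exp.mpr (pow_le_pow_left₀ (norm_nonneg z) (hR z hz) 2)
  have hGd : Differentiable ℂ G := by
    rw [← differentiableOn_univ]
    exact hloc.differentiableOn (Eventually.of_forall fun n => (hFd n).differentiableOn)
      isOpen_univ
  obtain ⟨φ, hφ, hae⟩ := (tendstoInMeasure_of_tendsto_Lp hlim).exists_seq_tendsto_ae
  refine ⟨G, hGd, ?_⟩
  filter_upwards [hae, ae_all_iff.mpr hFu] with z hz hz'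
  simp only [hz'] at hz
  exact tendsto_nhds_unique hz
    ((hloc.tendsto_at (Set.mem_univ z)).comp hφ.tendsto_atTop)

instance : CompleteSpace fock := isClosed_fock.completeSpace_coe

/-- A vector orthogonal to every kernel vanishes at every point. -/
theorem denseRange_reproKernel :
    DenseRange (Finsupp.linearCombination ℂ reproKernel) := by
  have h : (LinearMap.range (Finsupp.linearCombination ℂ reproKernel)).topologicalClosure = ⊤ := by
    rw [Submodule.topologicalClosure_eq_top_iff, Submodule.eq_bot_iff]
    intro f hf
    refine fock_ext fun z => ?_
    rw [inner_zero_right]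
    refine (Submodule.mem_orthogonal _ _).mp hf _ ⟨Finsupp.single z 1, ?_⟩
    simp
  have := Submodule.dense_iff_topologicalClosure_eq_top.mpr h
  rwa [DenseRange, ← LinearMap.coe_range]

theorem continuousLinearMap_ext_reproKernel {E : Type*} [NormedAddCommGroup E] [NormedSpace ℂ E]
    {A B : fock →L[ℂ] E} (h : ∀ a, A (reproKernel a) = B (reproKernel a)) : A = B := by
  have hfun : (A : fock → E) = B := by
    refine denseRange_reproKernel.equalizer A.continuous B.continuous (funext fun x => ?_)
    simp only [Function.comp_apply, Finsupp.linearCombination_apply, Finsupp.sum, map_sum, map_smul,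
      h]
  exact DFunLike.coe_injective hfun

/-- The norm of a finite combination depends only on the Gram matrix, so the map on the dense span
is well defined and isometric. -/
theorem exists_linearIsometry_of_inner_eq {h : ℂ → fock}
    (hh : ∀ a b, inner ℂ (h a) (h b) = inner ℂ (reproKernel a) (reproKernel b)) :
    ∃ V : fock →ₗᵢ[ℂ] fock, ∀ a, V (reproKernel a) = h a := by
  have hnorm : ∀ x : ℂ →₀ ℂ, ‖Finsupp.linearCombination ℂ h x‖ =
      ‖Finsupp.linearCombination ℂ reproKernel x‖ := by
    intro x
    have e : inner ℂ (Finsupp.linearCombination ℂ h x) (Finsupp.linearCombination ℂ h x) =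
        inner ℂ (Finsupp.linearCombination ℂ reproKernel x)
          (Finsupp.linearCombination ℂ reproKernel x) := by
      simp only [Finsupp.linearCombination_apply, Finsupp.sum, sum_inner, inner_sum,
        inner_smul_left, inner_smul_right, hh]
    rw [@norm_eq_sqrt_re_inner ℂ, @norm_eq_sqrt_re_inner ℂ, e]
  have hbd : ∀ x : ℂ →₀ ℂ, ‖Finsupp.linearCombination ℂ h x‖ ≤
      1 * ‖Finsupp.linearCombination ℂ reproKernel x‖ := fun x => by rw [one_mul, hnorm]
  set V := (Finsupp.linearCombination ℂ h).extendOfNorm (Finsupp.linearCombination ℂ reproKernel)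
    with hV
  have hVx : ∀ x, V (Finsupp.linearCombination ℂ reproKernel x) =
      Finsupp.linearCombination ℂ h x := fun x =>
    LinearMap.extendOfNorm_eq denseRange_reproKernel ⟨1, hbd⟩ x
  refine ⟨⟨V.toLinearMap, fun f => ?_⟩, fun a => ?_⟩
  · refine congrFun (denseRange_reproKernel.equalizer (g := fun f => ‖V f‖) (h := fun f => ‖f‖)
      V.continuous.norm continuous_norm (funext fun x => ?_)) f
    simp only [Function.comp_apply, hVx, hnorm]
  · simpa using hVx (Finsupp.single a 1)

/-! ### The kernel of the transform and unitarity. -/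

theorem exists_inner_gaussianFun {α' α : ℂ} (hα' : ‖α'‖ < 1) (hα : ‖α‖ < 1) :
    ∃ C : ℂ, (α' = α → C = ((Real.sqrt (1 - ‖α‖ ^ 2))⁻¹ : ℝ)) ∧ ∀ β' β : ℂ,
      inner ℂ (gaussianFun α' hα' β') (gaussianFun α hα β) =
        C * Complex.exp ((α * conj β' ^ 2 + conj α' * β ^ 2 + 2 * β * conj β') /
          (2 * (1 - α * conj α'))) := by
  obtain ⟨C, hC, h⟩ := exists_integral_gaussian_cexp (a := α) (b := conj α') hα (by simpa using hα')
  refine ⟨C, fun e => hC (by rw [e]), fun β' β => ?_⟩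
  rw [← h, Submodule.coe_inner]
  refine (inner_eq_integral (coeFn_ofEntire _ _ _) (coeFn_ofEntire _ _ _)).trans
    (integral_congr_ae (ae_of_all _ fun w => ?_))
  simp only [← Complex.exp_conj, ← Complex.exp_add]
  congr 1
  simp only [map_add, map_mul, map_div₀, map_pow, map_ofNat]
  ring

theorem inner_fock_smul_right (c : ℂ) (f g : fock) : inner ℂ f (c • g) = c * inner ℂ f g :=
  inner_smul_right f g c

theorem inner_fock_smul_left (c : ℂ) (f g : fock) :
    inner ℂ (c • f) g = conj c * inner ℂ f g :=
  inner_smul_left f g c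

theorem norm_csqrt (z : ℂ) : ‖csqrt z‖ = Real.sqrt ‖z‖ := by
  rw [csqrt, norm_mul, Complex.norm_real, Real.norm_of_nonneg (Real.sqrt_nonneg _), mul_comm
    Complex.I, Complex.norm_exp_ofReal_mul_I, mul_one]

theorem csqrt_ne_zero {z : ℂ} (hz : z ≠ 0) : csqrt z ≠ 0 := by
  rw [← norm_ne_zero_iff, norm_csqrt]
  exact (Real.sqrt_pos.mpr (norm_pos_iff.mpr hz)).ne'

/-- On the negative axis both sides differ by a sign, since the argument π is unchanged by
conjugation. -/
theorem csqrt_conj {z : ℂ} (hz : z.im ≠ 0) : csqrt (conj z) = conj (csqrt z) := by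
  have h : z.arg ≠ Real.pi := fun e => hz (Complex.arg_eq_pi_iff.mp e).2
  rw [csqrt, csqrt, Complex.arg_conj, if_neg h, map_mul, Complex.conj_ofReal, ← Complex.exp_conj,
    map_mul, Complex.conj_ofReal, Complex.conj_I, Complex.norm_conj]
  congr 2
  push_cast
  ring

theorem ne_zero_of_norm_sq {s t : ℂ} (hst : ‖s‖ ^ 2 = 1 + ‖t‖ ^ 2) : s ≠ 0 := by
  rintro rfl
  rw [norm_zero] at hst
  nlinarith [sq_nonneg ‖t‖]

theorem mul_conj_eq {s t : ℂ} (hst : ‖s‖ ^ 2 = 1 + ‖t‖ ^ 2) : s * conj s = 1 + t * conj t := by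
  rw [Complex.mul_conj, Complex.mul_conj, Complex.normSq_eq_norm_sq, Complex.normSq_eq_norm_sq, hst]
  push_cast
  rfl

theorem norm_neg_div_conj_lt_one {s t : ℂ} (hst : ‖s‖ ^ 2 = 1 + ‖t‖ ^ 2) :
    ‖-t / conj s‖ < 1 := by
  have hs := norm_pos_iff.mpr (ne_zero_of_norm_sq hst)
  rw [norm_div, norm_neg, Complex.norm_conj, div_lt_one hs]
  exact lt_of_pow_lt_pow_left₀ 2 hs.le (by linarith)

/-- The function `w ↦ conj (kernel s t z w)` as an element of the Fock space. -/
noncomputable def conjKernel (s t : ℂ) (hst : ‖s‖ ^ 2 = 1 + ‖t‖ ^ 2) (z : ℂ) : fock :=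
  (1 / conj (csqrt s) * Complex.exp (conj t * conj z ^ 2 / (2 * conj s))) •
    gaussianFun (-t / conj s) (norm_neg_div_conj_lt_one hst) (conj z / conj s)

theorem conj_kernel_eq {s t : ℂ} (z w : ℂ) :
    conj (kernel s t z w) = 1 / conj (csqrt s) *
      Complex.exp (conj t * conj z ^ 2 / (2 * conj s)) *
      Complex.exp (-t / conj s * w ^ 2 / 2 + conj z / conj s * w) := by
  rw [kernel, map_mul, map_div₀, map_one, ← Complex.exp_conj, mul_assoc (1 / conj (csqrt s)),
    ← Complex.exp_add]
  congr 2
  simp only [map_div₀, map_mul, map_add, map_sub, map_pow, Complex.conj_conj, map_ofNat]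
  ring

theorem coeFn_conjKernel {s t : ℂ} (hst : ‖s‖ ^ 2 = 1 + ‖t‖ ^ 2) (z : ℂ) :
    ((conjKernel s t hst z : Lp ℂ 2 gaussian) : ℂ → ℂ) =ᵐ[gaussian]
      fun w => conj (kernel s t z w) := by
  have h : ((gaussianFun (-t / conj s) (norm_neg_div_conj_lt_one hst) (conj z / conj s) :
      Lp ℂ 2 gaussian) : ℂ → ℂ) =ᵐ[gaussian]
      fun w => Complex.exp (-t / conj s * w ^ 2 / 2 + conj z / conj s * w) := coeFn_ofEntire _ _ _
  refine (Lp.coeFn_smul _ _).trans ?_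
  filter_upwards [h] with w hw
  rw [Pi.smul_apply, hw, conj_kernel_eq, smul_eq_mul]

theorem inner_reproKernel_conjKernel {s t : ℂ} (hst : ‖s‖ ^ 2 = 1 + ‖t‖ ^ 2) (z w : ℂ) :
    inner ℂ (reproKernel w) (conjKernel s t hst z) = conj (kernel s t z w) := by
  rw [conjKernel, inner_fock_smul_right, inner_reproKernel_gaussianFun, conj_kernel_eq]

theorem inner_conjKernel_conjKernel {s t : ℂ} (hst : ‖s‖ ^ 2 = 1 + ‖t‖ ^ 2) (z w : ℂ) :
    inner ℂ (conjKernel s t hst z) (conjKernel s t hst w) =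
      inner ℂ (reproKernel z) (reproKernel w) := by
  have hα := norm_neg_div_conj_lt_one hst
  obtain ⟨C, hC, h⟩ := exists_inner_gaussianFun hα hα
  have hs := ne_zero_of_norm_sq hst
  have hs' : conj s ≠ 0 := (map_ne_zero _).mpr hs
  have hn : 0 < ‖s‖ := norm_pos_iff.mpr hs
  have hss := mul_conj_eq hst
  have hCs : C = (‖s‖ : ℂ) := by
    rw [hC rfl, norm_div, norm_neg, Complex.norm_conj]
    -- By |s|² = 1 + |t|² the integral contributes exactly |s|, which cancels the two prefactors
    -- 1/√s.
    have : 1 - (‖t‖ / ‖s‖) ^ 2 = (‖s‖⁻¹) ^ 2 := by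
      field_simp
      linarith
    rw [this, Real.sqrt_sq (by positivity), inv_inv]
  have hroot : csqrt s * conj (csqrt s) = (‖s‖ : ℂ) := by
    rw [Complex.mul_conj, Complex.normSq_eq_norm_sq, norm_csqrt, Real.sq_sqrt hn.le]
  have hr := csqrt_ne_zero hs
  have hr' : conj (csqrt s) ≠ 0 := (map_ne_zero _).mpr hr
  have hden : 1 - -t / conj s * conj (-t / conj s) = 1 / (s * conj s) := by
    simp only [map_div₀, map_neg, Complex.conj_conj]
    field_simp
    linear_combination hss
  rw [conjKernel, conjKernel, inner_fock_smul_left, inner_fock_smul_right, h, inner_reproKernel_reproKernel,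
    hCs, ← hroot, hden]
  simp only [map_mul, map_div₀, map_one, Complex.conj_conj, map_neg, ← Complex.exp_conj, map_pow,
    map_ofNat]
  have e : ∀ x y u v : ℂ, 1 / csqrt s * Complex.exp x * (1 / conj (csqrt s) * Complex.exp y *
      (csqrt s * conj (csqrt s) * Complex.exp u)) = Complex.exp (x + y + u) := by
    intro x y u v
    rw [Complex.exp_add, Complex.exp_add]
    field_simp
  rw [e _ _ _ 0]
  congr 1
  field_simp
  ring

theorem conj_kernel_conj_neg {s t : ℂ} (hs : s.im ≠ 0) (z w : ℂ) :
    conj (kernel (conj s) (-t) w z) = kernel s t z w := by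
  rw [kernel, kernel, csqrt_conj hs, map_mul, map_div₀, map_one, ← Complex.exp_conj,
    Complex.conj_conj]
  congr 2
  simp only [map_div₀, map_mul, map_add, map_sub, map_pow, Complex.conj_conj, map_ofNat, map_neg]
  ring

theorem im_sq_eq {s t : ℂ} (hst : ‖s‖ ^ 2 = 1 + ‖t‖ ^ 2) :
    s.im ^ 2 = ‖t‖ ^ 2 + (1 - s.re ^ 2) := by
  rw [← Complex.normSq_eq_norm_sq, Complex.normSq_apply] at hst
  linarith

theorem one_sub_re_sq_pos {s : ℂ} (hs : |s.re| < 1) : 0 < 1 - s.re ^ 2 := by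
  have := (sq_lt_one_iff_abs_lt_one s.re).mpr hs
  linarith

/-- The transform is unitary, with adjoint determined by `conjKernel`. -/
theorem exists_unitary {s t : ℂ} (hst : ‖s‖ ^ 2 = 1 + ‖t‖ ^ 2) (him : s.im ≠ 0) :
    ∃ U : fock ≃ₗᵢ[ℂ] fock, ∀ z f,
      inner ℂ (reproKernel z) (U f) = inner ℂ (conjKernel s t hst z) f := by
  have hst' : ‖conj s‖ ^ 2 = 1 + ‖-t‖ ^ 2 := by rwa [Complex.norm_conj, norm_neg]
  obtain ⟨V, hV⟩ := exists_linearIsometry_of_inner_eq (inner_conjKernel_conjKernel hst)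
  obtain ⟨V', hV'⟩ := exists_linearIsometry_of_inner_eq (inner_conjKernel_conjKernel hst')
  have hadj : ∀ z f, inner ℂ (reproKernel z) (V' f) = inner ℂ (conjKernel s t hst z) f := by
    intro z f
    have := continuousLinearMap_ext_reproKernel
      (A := (innerSL ℂ (reproKernel z)).comp V'.toContinuousLinearMap)
      (B := innerSL ℂ (conjKernel s t hst z)) fun a => by
        simp only [ContinuousLinearMap.comp_apply, LinearIsometry.coe_toContinuousLinearMap, hV',
          innerSL_apply_apply, inner_reproKernel_conjKernel]
        rw [← inner_conj_symm, inner_reproKernel_conjKernel, Complex.conj_conj,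
          conj_kernel_conj_neg him]
    simpa using DFunLike.congr_fun this f
  -- `V` is a right inverse: ⟨K_z, V' V f⟩ = ⟨V K_z, V f⟩ = ⟨K_z, f⟩.
  have hsurj : Function.Surjective V' := fun f => ⟨V f, fock_ext fun z => by
    rw [hadj, ← hV, V.inner_map_map]⟩
  exact ⟨LinearIsometryEquiv.ofSurjective V' hsurj, hadj⟩

theorem isIntegralOperator_of_inner_eq {s t : ℂ} (hst : ‖s‖ ^ 2 = 1 + ‖t‖ ^ 2)
    {T : fock →L[ℂ] fock}
    (h : ∀ z f, inner ℂ (reproKernel z) (T f) = inner ℂ (conjKernel s t hst z) f) :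
    IsIntegralOperator s t T := by
  intro f
  have htr : transform s t ((f : Lp ℂ 2 gaussian) : ℂ → ℂ) =
      fun z => inner ℂ (reproKernel z) (T f) := by
    ext z
    rw [h, Submodule.coe_inner, inner_eq_integral (coeFn_conjKernel hst z) Filter.EventuallyEq.rfl]
    simp only [Complex.conj_conj]
    rfl
  refine ⟨fun z => ?_, ?_, ?_⟩
  · refine (L2.integrable_inner (𝕜 := ℂ) (conjKernel s t hst z : Lp ℂ 2 gaussian) f).congr ?_
    filter_upwards [coeFn_conjKernel hst z] with w hw
    rw [hw, RCLike.inner_apply, Complex.conj_conj, mul_comm]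
  · rw [htr]
    exact differentiable_inner_reproKernel _
  · rw [htr]
    exact coeFn_eq_inner_reproKernel _

/-! ### The root γ and the angle θ. -/

/-- With |s|² = 1 + |t|² the quadratic factors as s times the fixed-point equation of γ ↦ (s̄γ +
t)/(t̄γ + s). -/
theorem isDiskRoot_iff {s t γ : ℂ} (hst : ‖s‖ ^ 2 = 1 + ‖t‖ ^ 2) :
    IsDiskRoot s t γ ↔ ‖γ‖ < 1 ∧ conj t * γ ^ 2 + (s - conj s) * γ - t = 0 := by
  have hs := ne_zero_of_norm_sq hst
  have h := mul_conj_eq hst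
  have e : s * conj t * γ ^ 2 + (s ^ 2 - 1 - (‖t‖ : ℂ) ^ 2) * γ - s * t =
      s * (conj t * γ ^ 2 + (s - conj s) * γ - t) := by
    rw [← Complex.mul_conj']
    linear_combination γ * h
  rw [IsDiskRoot, e, mul_eq_zero, or_iff_right hs]

/-- Two distinct roots in the disk would give 2|Im s| = |t||γ₁ + γ₂| ≤ 2|t|, against (Im s)² = |t|²
+ 1 - (Re s)². -/
theorem eq_of_isDiskRoot {s t γ₁ γ₂ : ℂ} (hst : ‖s‖ ^ 2 = 1 + ‖t‖ ^ 2) (hs : |s.re| < 1)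
    (h₁ : IsDiskRoot s t γ₁) (h₂ : IsDiskRoot s t γ₂) : γ₁ = γ₂ := by
  obtain ⟨n₁, e₁⟩ := (isDiskRoot_iff hst).mp h₁
  obtain ⟨n₂, e₂⟩ := (isDiskRoot_iff hst).mp h₂
  by_contra hne
  have h : conj t * (γ₁ + γ₂) = -(s - conj s) := by
    have : (γ₁ - γ₂) * (conj t * (γ₁ + γ₂) + (s - conj s)) = 0 := by linear_combination e₁ - e₂
    have := (mul_eq_zero.mp this).resolve_left (sub_ne_zero.mpr hne)
    linear_combination this
  have hn := congrArg norm h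
  rw [norm_mul, norm_neg, Complex.norm_conj, Complex.sub_conj, norm_mul, Complex.norm_I, mul_one,
    Complex.norm_real, norm_mul, Real.norm_ofNat, Real.norm_eq_abs] at hn
  have hle : 2 * |s.im| ≤ ‖t‖ * 2 := by
    rw [← hn]
    gcongr
    linarith [norm_add_le γ₁ γ₂]
  have hsq : s.im ^ 2 ≤ ‖t‖ ^ 2 := by
    rw [← sq_abs]
    gcongr
    linarith
  linarith [im_sq_eq hst, one_sub_re_sq_pos hs]

theorem existsUnique_isDiskRoot {s t : ℂ} (hst : ‖s‖ ^ 2 = 1 + ‖t‖ ^ 2) (hs : |s.re| < 1) :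
    ∃! γ : ℂ, IsDiskRoot s t γ := by
  have hr := one_sub_re_sq_pos hs
  have him := im_sq_eq hst
  have hconj : s - conj s = 2 * Complex.I * s.im := by
    rw [Complex.sub_conj]; push_cast; ring
  -- Substituting γ = t/(id) gives d² - 2(Im s)d + |t|² = 0. The real roots have product |t|², and
  -- the one of larger modulus puts γ inside the disk.
  have hd : ∃ d : ℝ, ‖t‖ ^ 2 < d ^ 2 ∧ 2 * s.im * d = d ^ 2 + ‖t‖ ^ 2 := by
    have hq := Real.sq_sqrt hr.le
    have hq0 := Real.sqrt_pos.mpr hr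
    rcases le_total 0 s.im with h | h
    · exact ⟨s.im + √(1 - s.re ^ 2), by nlinarith, by nlinarith⟩
    · exact ⟨s.im - √(1 - s.re ^ 2), by nlinarith, by nlinarith⟩
  obtain ⟨d, hd1, hd2⟩ := hd
  have hd0 : d ≠ 0 := by rintro rfl; nlinarith [sq_nonneg ‖t‖]
  have hdc : (d : ℂ) ≠ 0 := Complex.ofReal_ne_zero.mpr hd0
  suffices hroot : IsDiskRoot s t (t / (Complex.I * d)) from
    ⟨_, hroot, fun γ hγ => eq_of_isDiskRoot hst hs hγ hroot⟩
  refine (isDiskRoot_iff hst).mpr ⟨?_, ?_⟩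
  · rw [norm_div, norm_mul, Complex.norm_I, one_mul, Complex.norm_real,
      div_lt_one (norm_pos_iff.mpr hd0)]
    refine lt_of_pow_lt_pow_left₀ 2 (norm_nonneg d) ?_
    rwa [Real.norm_eq_abs, sq_abs]
  · have hd2' : 2 * (s.im : ℂ) * d = d ^ 2 + t * conj t := by
      rw [Complex.mul_conj']
      exact_mod_cast hd2
    rw [hconj]
    field_simp
    rw [Complex.I_sq]
    linear_combination (-t) * hd2'

/-- The number u = s + t̄γ solves u² - 2(Re s)u + 1 = 0, whose roots are nonreal conjugates with
product 1. -/
theorem norm_add_mul_eq_one {s t γ : ℂ} (hst : ‖s‖ ^ 2 = 1 + ‖t‖ ^ 2) (hs : |s.re| < 1)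
    (hγ : IsDiskRoot s t γ) : ‖s + conj t * γ‖ = 1 := by
  obtain ⟨-, h⟩ := (isDiskRoot_iff hst).mp hγ
  have hr := one_sub_re_sq_pos hs
  have hss := mul_conj_eq hst
  set u := s + conj t * γ with hu
  have hre : s + conj s = 2 * (s.re : ℂ) := by rw [Complex.add_conj]; push_cast; ring
  have hq : u ^ 2 - 2 * (s.re : ℂ) * u + 1 = 0 := by
    rw [← hre, hu]
    linear_combination conj t * h - hss
  have h1 := congrArg Complex.re hq
  have h2 := congrArg Complex.im hq
  simp [sq] at h1 h2
  have h3 : u.im * (u.re - s.re) = 0 := by linarith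
  have h4 : u.re ^ 2 + u.im ^ 2 = 1 := by
    rcases mul_eq_zero.mp h3 with h3 | h3
    -- A real u would give (u - Re s)² = (Re s)² - 1 < 0.
    · rw [h3] at h1
      nlinarith [sq_nonneg (u.re - s.re)]
    · rw [sub_eq_zero.mp h3] at h1 ⊢
      nlinarith
  rw [← sq_eq_sq₀ (norm_nonneg u) zero_le_one, ← Complex.normSq_eq_norm_sq, Complex.normSq_apply]
  linarith

theorem existsUnique_isAngle {s t γ : ℂ} (hst : ‖s‖ ^ 2 = 1 + ‖t‖ ^ 2) (hs : |s.re| < 1)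
    (hγ : IsDiskRoot s t γ) : ∃! θ : ℝ, IsAngle s t γ θ := by
  have hu := norm_add_mul_eq_one hst hs hγ
  refine ⟨(1 / (s + conj t * γ)).arg, ⟨Complex.arg_mem_Ioc _, ?_⟩, ?_⟩
  · have h := Complex.norm_mul_exp_arg_mul_I (1 / (s + conj t * γ))
    rw [norm_div, norm_one, hu, div_one, Complex.ofReal_one, one_mul] at h
    rw [mul_comm Complex.I, h]
  · rintro θ ⟨hθ, h⟩
    rw [h, mul_comm, Complex.arg_exp_mul_I, (toIocMod_eq_self _).mpr]
    rwa [show -Real.pi + 2 * Real.pi = Real.pi by ring]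

/-! ### Density of the eigenvalues. -/

theorem denseRange_exp_pow {θ : ℝ} (hθ : ¬ ∃ q : ℚ, θ = (q : ℝ) * Real.pi) :
    DenseRange fun n : ℕ => Circle.exp θ ^ n := by
  have hirr : Irrational (θ / (2 * Real.pi)) := by
    rintro ⟨q, hq⟩
    refine hθ ⟨2 * q, ?_⟩
    rw [eq_div_iff (by positivity)] at hq
    push_cast
    linarith
  have h1 := AddCircle.denseRange_zsmul_coe_iff.mpr hirr
  have : Fact (0 < 2 * Real.pi) := ⟨Real.two_pi_pos⟩
  -- Only nonnegative powers occur, as monomials have degree n ≥ 0.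
  have h2 := (denseRange_zsmul_iff_nsmul (G := AddCircle (2 * Real.pi))).mp h1
  have h3 := AddCircle.homeomorphCircle'.surjective.denseRange.comp h2
    AddCircle.homeomorphCircle'.continuous
  convert h3 using 2 with n
  simp only [Function.comp_apply, ← AddCircle.coe_nsmul, AddCircle.homeomorphCircle'_apply_mk]
  rw [Circle.exp_nsmul]

theorem closure_mul_exp_pow {θ : ℝ} (hθ : ¬ ∃ q : ℚ, θ = (q : ℝ) * Real.pi) {c : ℂ}
    (hc : ‖c‖ = 1) :
    Metric.sphere (0 : ℂ) 1 ⊆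
      closure (Set.range fun n : ℕ => c * Complex.exp (Complex.I * θ) ^ n) := by
  intro z hz
  have hc0 : c ≠ 0 := by rintro rfl; simp at hc
  have hw : ‖c⁻¹ * z‖ = 1 := by
    rw [norm_mul, norm_inv, hc, mem_sphere_zero_iff_norm.mp hz]; simp
  have h := denseRange_exp_pow hθ ⟨c⁻¹ * z, mem_sphere_zero_iff_norm.mpr hw⟩
  have hcont : Continuous fun u : Circle => c * (u : ℂ) := by fun_prop
  have h' := image_closure_subset_closure_image hcont (Set.mem_image_of_mem _ h)
  simp only [mul_inv_cancel_left₀ hc0] at h'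
  rw [← Set.range_comp] at h'
  convert h' using 3
  ext n
  simp [mul_comm Complex.I]

/-! ### Monomials, rotations and the intertwining isometry. -/

theorem memLp_pow (n : ℕ) : MemLp (fun z : ℂ => z ^ n) 2 gaussian := by
  refine memLp_gaussian_of_norm_le (A := n.factorial) (a := 0) (d := 1) (by fun_prop)
    (by norm_num) fun z => ?_
  have h := Real.pow_div_factorial_le_exp ‖z‖ (norm_nonneg z) n
  rw [div_le_iff₀' (by positivity)] at h
  simpa using h

/-- The monomial `z ^ n` as an element of the Fock space. -/
noncomputable def monomial (n : ℕ) : fock :=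
  ofEntire (fun z => z ^ n) (by fun_prop) (memLp_pow n)

theorem inner_reproKernel_monomial (n : ℕ) (z : ℂ) :
    inner ℂ (reproKernel z) (monomial n) = z ^ n :=
  inner_reproKernel_ofEntire _ _ z

theorem monomial_ne_zero (n : ℕ) : monomial n ≠ 0 := by
  intro h
  have := inner_reproKernel_monomial n 1
  simp [h] at this

/-- The isometry is R f(z) = f(ωz), obtained from its action on kernels. -/
theorem exists_rotation {ω : ℂ} (hω : ‖ω‖ = 1) :
    ∃ R : fock →ₗᵢ[ℂ] fock, (∀ a, R (reproKernel a) = reproKernel (conj ω * a)) ∧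
      ∀ n, R (monomial n) = ω ^ n • monomial n := by
  have hωω : ω * conj ω = 1 := by rw [Complex.mul_conj, Complex.normSq_eq_norm_sq, hω]; simp
  obtain ⟨R, hR⟩ := exists_linearIsometry_of_inner_eq
    (h := fun a => reproKernel (conj ω * a)) fun a b => by
      simp only [inner_reproKernel_reproKernel, map_mul, Complex.conj_conj]
      congr 1
      linear_combination (conj b * a) * hωω
  refine ⟨R, hR, fun n => fock_ext fun z => ?_⟩
  have hz : ∀ f, inner ℂ (reproKernel z) (R f) = inner ℂ (reproKernel (ω * z)) f := by
    intro f
    have := continuousLinearMap_ext_reproKernel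
      (A := (innerSL ℂ (reproKernel z)).comp R.toContinuousLinearMap)
      (B := innerSL ℂ (reproKernel (ω * z))) fun a => by
        simp only [ContinuousLinearMap.comp_apply, LinearIsometry.coe_toContinuousLinearMap, hR,
          innerSL_apply_apply, inner_reproKernel_reproKernel, map_mul, Complex.conj_conj]
        congr 1
        ring
    simpa using DFunLike.congr_fun this f
  rw [hz, inner_reproKernel_monomial, inner_fock_smul_right, inner_reproKernel_monomial, mul_pow]

/-- The unitary with kernel `kernel s t` is intertwined, up to a scalar, with a rotation. -/
theorem exists_intertwining {s t γ ω : ℂ} (hst : ‖s‖ ^ 2 = 1 + ‖t‖ ^ 2) (hs : |s.re| < 1)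
    (hγ : IsDiskRoot s t γ) (hω : 1 / (s + conj t * γ) = ω) {U : fock ≃ₗᵢ[ℂ] fock}
    (hU : ∀ z f, inner ℂ (reproKernel z) (U f) = inner ℂ (conjKernel s t hst z) f) :
    ∃ (W : fock →ₗᵢ[ℂ] fock) (c : ℂ),
      ∀ a, U (W (reproKernel a)) = c • W (reproKernel (conj ω * a)) := by
  have hu := norm_add_mul_eq_one hst hs hγ
  obtain ⟨hγ1, heq⟩ := (isDiskRoot_iff hst).mp hγ
  have hs0 := ne_zero_of_norm_sq hst
  have hpos : 0 < 1 - ‖γ‖ ^ 2 := by nlinarith [norm_nonneg γ]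
  -- This makes the pair (r, -γr) satisfy the norm relation, and its `conjKernel` has quadratic
  -- coefficient γ.
  set r : ℝ := (√(1 - ‖γ‖ ^ 2))⁻¹ with hr
  have hr0 : 0 < r := by positivity
  have hrc : (r : ℂ) ≠ 0 := Complex.ofReal_ne_zero.mpr hr0.ne'
  have hr2 : r ^ 2 * (1 - ‖γ‖ ^ 2) = 1 := by
    rw [hr, inv_pow, Real.sq_sqrt hpos.le, inv_mul_cancel₀ hpos.ne']
  have hst0 : ‖(r : ℂ)‖ ^ 2 = 1 + ‖-γ * r‖ ^ 2 := by
    rw [norm_mul, norm_neg, Complex.norm_real, Real.norm_of_nonneg hr0.le]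
    linear_combination hr2
  obtain ⟨W, hW⟩ := exists_linearIsometry_of_inner_eq (inner_conjKernel_conjKernel hst0)
  obtain ⟨C, -, hC⟩ := exists_inner_gaussianFun (norm_neg_div_conj_lt_one hst)
    (norm_neg_div_conj_lt_one hst0)
  refine ⟨W, C / csqrt s, fun a => fock_ext fun z => ?_⟩
  rw [hU, hW, hW, inner_fock_smul_right, inner_reproKernel_conjKernel, conj_kernel_eq, conjKernel,
    conjKernel, inner_fock_smul_left, inner_fock_smul_right, hC]
  have hα : -(-γ * (r : ℂ)) / conj (r : ℂ) = γ := by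
    rw [Complex.conj_ofReal]; field_simp
  rw [hα]
  simp only [map_mul, map_div₀, map_one, map_neg, Complex.conj_conj, Complex.conj_ofReal,
    ← Complex.exp_conj, map_pow, map_ofNat]
  set u := s + conj t * γ with hudef
  have hu0 : u ≠ 0 := by rintro h; rw [h] at hu; simp at hu
  have huu : u * conj u = 1 := by rw [Complex.mul_conj, Complex.normSq_eq_norm_sq, hu]; simp
  have hωu : ω = conj u := by rw [← hω, eq_comm, eq_div_iff hu0, mul_comm, huu]
  have hr2c : (r : ℂ) ^ 2 * (1 - γ * conj γ) = 1 := by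
    rw [Complex.mul_conj']
    exact_mod_cast hr2
  have hden : 1 - γ * (-conj t / s) = u / s := by
    rw [hudef]; field_simp; ring
  rw [hden]
  have hexp : t * z ^ 2 / (2 * s) + -conj γ * r * conj a ^ 2 / (2 * r) +
      (γ * (z / s) ^ 2 + -conj t / s * (conj a / r) ^ 2 + 2 * (conj a / r) * (z / s)) /
        (2 * (u / s)) =
      -conj γ * r * (ω * conj a) ^ 2 / (2 * r) + (γ * z ^ 2 / 2 + ω * conj a / r * z) := by
    have huω : u * ω = 1 := by rw [hωu, huu]
    have hωeq : ω = conj s + t * conj γ := by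
      rw [hωu, hudef, map_add, map_mul, Complex.conj_conj]
    have hss := mul_conj_eq hst
    have hcheq : t * conj γ ^ 2 + (conj s - s) * conj γ - conj t = 0 := by
      have := congrArg conj heq
      simpa only [map_add, map_sub, map_mul, map_pow, Complex.conj_conj, map_zero] using this
    -- The coefficient of z²: the fixed-point equation says that the transform preserves γ.
    have hE1 : (t + γ * ω) / s = γ := by
      rw [div_eq_iff hs0]
      refine mul_left_cancel₀ hu0 ?_
      linear_combination (norm := skip) γ * huω - s * heq - γ * hss
      rw [hudef]
      ring
    -- The coefficient of ā²: replacing a by ω̄a multiplies ā² by ω².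
    have hE2 : conj γ + conj t * ω * (1 / (r : ℂ) ^ 2) = conj γ * ω ^ 2 := by
      have h1 : 1 / (r : ℂ) ^ 2 = 1 - γ * conj γ := by
        rw [div_eq_iff (pow_ne_zero 2 hrc), mul_comm, hr2c]
      rw [h1]
      linear_combination (norm := skip) (-conj γ) * huω - ω * hcheq
      rw [hudef, hωeq]
      ring
    have hL : t * z ^ 2 / (2 * s) + -conj γ * r * conj a ^ 2 / (2 * r) +
        (γ * (z / s) ^ 2 + -conj t / s * (conj a / r) ^ 2 + 2 * (conj a / r) * (z / s)) /
          (2 * (u / s)) =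
        z ^ 2 / 2 * ((t + γ * ω) / s) -
          conj a ^ 2 / 2 * (conj γ + conj t * ω * (1 / (r : ℂ) ^ 2)) +
            ω * conj a / r * z := by
      rw [← hω]
      clear_value u
      field_simp
      ring
    rw [hL, hE1, hE2]
    field_simp
    ring
  have e : ∀ k₁ k₂ k₃ x y v x' y' : ℂ, x + y + v = x' + y' →
      k₁ * Complex.exp x * (k₂ * Complex.exp y * (k₃ * Complex.exp v)) =
      k₃ * k₁ * (k₂ * Complex.exp x' * Complex.exp y') := by
    intro k₁ k₂ k₃ x y v x' y' h
    have := congrArg Complex.exp h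
    rw [Complex.exp_add, Complex.exp_add, Complex.exp_add] at this
    linear_combination (k₁ * k₂ * k₃) * this
  rw [e _ _ _ _ _ _ _ _ hexp]
  ring

/-! ### Spectrum from eigenvectors. -/

section HilbertSpace

variable {H : Type*} [NormedAddCommGroup H] [InnerProductSpace ℂ H]

theorem mem_spectrum_of_apply_eq {T : H →L[ℂ] H} {f : H} {μ : ℂ} (hf : f ≠ 0)
    (h : T f = μ • f) : μ ∈ spectrum ℂ T := by
  rw [spectrum.mem_iff]
  rintro ⟨B, hB⟩
  apply hf
  have h1 : (B : H →L[ℂ] H) f = 0 := by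
    rw [hB, sub_apply, h, Algebra.algebraMap_eq_smul_one, smul_apply, one_apply_eq_self, sub_self]
  have h2 := DFunLike.congr_fun B.inv_mul f
  rw [mul_apply_eq_comp, h1, map_zero] at h2
  exact h2.symm

variable [CompleteSpace H]

theorem spectrum_linearIsometryEquiv_subset (U : H ≃ₗᵢ[ℂ] H) :
    spectrum ℂ (U.toContinuousLinearEquiv : H →L[ℂ] H) ⊆ Metric.sphere (0 : ℂ) 1 := by
  rcases subsingleton_or_nontrivial H with _ | _
  · rw [spectrum.of_subsingleton]
    exact Set.empty_subset _
  · have h : (U.toContinuousLinearEquiv : H →L[ℂ] H) =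
        (Unitary.linearIsometryEquiv.symm U : unitary (H →L[ℂ] H)) := by
      ext x
      simp
    rw [h]
    exact Unitary.spectrum_subset_circle (E := H →L[ℂ] H) _

/-- A unitary operator with eigenvalues `c * exp(iθ) ^ n` for all `n` has full spectrum when `θ`
is not a rational multiple of `π`. -/
theorem spectrum_eq_sphere_of_eigenvectors {θ : ℝ} (hirr : ¬ ∃ q : ℚ, θ = (q : ℝ) * Real.pi)
    (U : H ≃ₗᵢ[ℂ] H) {c : ℂ} {v : ℕ → H} (hv : ∀ n, v n ≠ 0)
    (h : ∀ n, U (v n) = (c * Complex.exp (Complex.I * θ) ^ n) • v n) :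
    spectrum ℂ (U.toContinuousLinearEquiv : H →L[ℂ] H) = Metric.sphere (0 : ℂ) 1 := by
  refine (spectrum_linearIsometryEquiv_subset U).antisymm ?_
  have hmem : ∀ n : ℕ, c * Complex.exp (Complex.I * θ) ^ n ∈
      spectrum ℂ (U.toContinuousLinearEquiv : H →L[ℂ] H) := fun n =>
    mem_spectrum_of_apply_eq (hv n) (h n)
  -- For n = 0 the eigenvalue is c itself, and it lies on the circle.
  have hc : ‖c‖ = 1 := by
    have := spectrum_linearIsometryEquiv_subset U (hmem 0)
    simpa using this
  refine (closure_mul_exp_pow hirr hc).trans (closure_minimal ?_ (spectrum.isClosed _))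
  rintro _ ⟨n, rfl⟩
  exact hmem n

end HilbertSpace

theorem exists_eigenvectors {s t γ : ℂ} {θ : ℝ} (hst : ‖s‖ ^ 2 = 1 + ‖t‖ ^ 2)
    (hs : |s.re| < 1) (hγ : IsDiskRoot s t γ) (hθ : IsAngle s t γ θ) {U : fock ≃ₗᵢ[ℂ] fock}
    (hU : ∀ z f, inner ℂ (reproKernel z) (U f) = inner ℂ (conjKernel s t hst z) f) :
    ∃ (c : ℂ) (v : ℕ → fock), (∀ n, v n ≠ 0) ∧
      ∀ n, U (v n) = (c * Complex.exp (Complex.I * θ) ^ n) • v n := by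
  obtain ⟨W, c, hW⟩ := exists_intertwining hst hs hγ hθ.2 hU
  obtain ⟨R, hR, hRn⟩ := exists_rotation (ω := Complex.exp (Complex.I * θ))
    (by rw [mul_comm, Complex.norm_exp_ofReal_mul_I])
  have hUW : ∀ f, U (W f) = c • W (R f) := by
    intro f
    have := continuousLinearMap_ext_reproKernel
      (A := (U.toLinearIsometry.comp W).toContinuousLinearMap)
      (B := c • (W.comp R).toContinuousLinearMap) fun a => by
        simpa [hR] using hW a
    simpa using DFunLike.congr_fun this f
  refine ⟨c, fun n => W (monomial n), fun n => ?_, fun n => ?_⟩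
  · rw [Ne, map_eq_zero_iff W W.injective]
    exact monomial_ne_zero n
  · rw [hUW, hRn, map_smul, smul_smul]

end FockLCT

theorem mainTheorem6 (s t : ℂ) (hst : ‖s‖ ^ 2 = 1 + ‖t‖ ^ 2) (hs : |s.re| < 1) :
    (∃! γ : ℂ, FockLCT.IsDiskRoot s t γ) ∧
    (∀ γ : ℂ, FockLCT.IsDiskRoot s t γ → ∃! θ : ℝ, FockLCT.IsAngle s t γ θ) ∧
    ∃ U : FockLCT.fock ≃ₗᵢ[ℂ] FockLCT.fock,
      FockLCT.IsIntegralOperator s t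
        (U.toContinuousLinearEquiv : FockLCT.fock →L[ℂ] FockLCT.fock) ∧
      ∀ (γ : ℂ) (θ : ℝ), FockLCT.IsDiskRoot s t γ → FockLCT.IsAngle s t γ θ →
        (¬ ∃ q : ℚ, θ = (q : ℝ) * Real.pi) →
        spectrum ℂ (U.toContinuousLinearEquiv : FockLCT.fock →L[ℂ] FockLCT.fock) =
          Metric.sphere (0 : ℂ) 1 := by
  -- This keeps s off the branch cut of `csqrt`.
  have him : s.im ≠ 0 := by
    intro h
    have h1 := FockLCT.im_sq_eq hst
    rw [h] at h1
    nlinarith [FockLCT.one_sub_re_sq_pos hs, sq_nonneg ‖t‖]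
  obtain ⟨U, hU⟩ := FockLCT.exists_unitary hst him
  refine ⟨FockLCT.existsUnique_isDiskRoot hst hs,
    fun γ hγ => FockLCT.existsUnique_isAngle hst hs hγ, U,
    FockLCT.isIntegralOperator_of_inner_eq hst hU, fun γ θ hγ hθ hirr => ?_⟩
  obtain ⟨c, v, hv, h⟩ := FockLCT.exists_eigenvectors hst hs hγ hθ hU
  exact FockLCT.spectrum_eq_sphere_of_eigenvectors hirr U hv h
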